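/- Let $N\ge 1$ and consider tensors $\mathcal X\in\mathbb R^{I_1\times\cdots\times I_N}$ with Frobenius norm $\|\mathcal X\|_F$ and mode-$n$ unfoldings $X_{(n)}$ (the matrix whose columns are the mode-$n$ fibers of $\mathcal X$). Put $\|\mathcal X\|_*:=\frac1N\sum_{n=1}^N\|X_{(n)}\|_*$, where $\|\cdot\|_*$ of a matrix is the sum of its singular values, and let $\|\cdot\|_2$ of a matrix denote its largest singular value. For a linear operator $\mathfrak F:\mathbb R^{I_1\times\cdots\times I_N}\to\mathbb R^p$ let $\delta_{(s_1,\dots,s_N)}$ be the smallest $\delta$ such that $$(1-\delta)\|\mathcal X\|_F^2\le\|\mathfrak F(\mathcal X)\|_2^2\le(1+\delta)\|\mathcal X\|_F^2$$ for all $\mathcal X$ with $\operatorname{rank}(X_{(n)})\le s_n$, $n=1,\dots,N$ (and $\delta_{(s_1,\dots,s_N)}:=0$ if $\mathcal X=0$ is the only such tensor). **Theorem.** Let $\mathcal X^0\in\mathbb R^{I_1\times\cdots\times I_N}$ satisfy $\operatorname{rank}(X^0_{(n)})\le r_n$ for $n=1,\dots,N$, and let $b=\mathfrak F(\mathcal X^0)$.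 Suppose that $\delta_{(I_1,\dots,I_{n-1},2r_n,I_{n+1},\dots,I_N)}<0.4404$ for every $n=1,\dots,N$, and let $\alpha>0$ satisfy $\alpha\ge 10\max_{n}\|X^0_{(n)}\|_2$. Then $\mathcal X^0$ is the unique solution of the augmented model $$\min_{\mathcal X}\Big\{\|\mathcal X\|_*+\frac1{2\alpha}\|\mathcal X\|_F^2:\ \mathfrak F(\mathcal X)=b\Big\}.$$ -/

import Mathlib

namespace TensorRecovery

/-- Real `N`-way tensors of size `I 0 × ⋯ × I (N - 1)`, with the Euclidean inner product of their
vectorizations; `‖X‖` is the Frobenius norm. -/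
abbrev Tensor {N : ℕ} (I : Fin N → ℕ) : Type :=
  EuclideanSpace ℝ ((k : Fin N) → Fin (I k))

/-- The multi-index whose `n`-th entry is `i` and whose other entries are given by `j`. -/
def insertIndex {N : ℕ} {I : Fin N → ℕ} (n : Fin N) (i : Fin (I n))
    (j : (k : {k : Fin N // k ≠ n}) → Fin (I k)) : (k : Fin N) → Fin (I k) :=
  fun k => if h : k = n then h ▸ i else j ⟨k, h⟩

/-- The mode-`n` unfolding of a tensor: the matrix whose columns are the mode-`n` fibers. The
columns are labelled by the remaining multi-indices instead of by their rank in an enumeration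
of these; neither the rank nor the singular values depend on the labelling of the columns. -/
def unfolding {N : ℕ} {I : Fin N → ℕ} (n : Fin N) (X : Tensor I) :
    Matrix (Fin (I n)) ((k : {k : Fin N // k ≠ n}) → Fin (I k)) ℝ :=
  Matrix.of fun i j => X (insertIndex n i j)

/-- The singular values of a real matrix, in decreasing order, numbered from `0` and continued
by zeros. -/
noncomputable def singularValue {m n : Type*} [Fintype m] [Fintype n] [DecidableEq n]
    (A : Matrix m n ℝ) : ℕ →₀ ℝ :=
  (Matrix.toEuclideanLin A).singularValues

/-- The trace norm of a matrix: the sum of its singular values. -/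
noncomputable def traceNorm {m n : Type*} [Fintype m] [Fintype n] [DecidableEq n]
    (A : Matrix m n ℝ) : ℝ :=
  (singularValue A).sum fun _ s => s

/-- The spectral norm of a matrix: its largest singular value. -/
noncomputable def matrixSpectralNorm {m n : Type*} [Fintype m] [Fintype n] [DecidableEq n]
    (A : Matrix m n ℝ) : ℝ :=
  singularValue A 0

/-- The trace norm of a tensor: the mean of the trace norms of its unfoldings. -/
noncomputable def tensorTraceNorm {N : ℕ} {I : Fin N → ℕ} (X : Tensor I) : ℝ :=
  1 / (N : ℝ) * ∑ n : Fin N, traceNorm (unfolding n X)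

/-- The tensors of multilinear rank at most `(r 0, …, r (N - 1))`. -/
def lowRank {N : ℕ} {I : Fin N → ℕ} (r : Fin N → ℕ) : Set (Tensor I) :=
  {X | ∀ n : Fin N, (unfolding n X).rank ≤ r n}

/-- The values `δ` for which the restricted isometry inequalities hold on all tensors of
multilinear rank at most `r`. -/
def ripBounds {N : ℕ} {I : Fin N → ℕ} {p : ℕ} (F : Tensor I →ₗ[ℝ] EuclideanSpace ℝ (Fin p))
    (r : Fin N → ℕ) : Set ℝ :=
  {δ | ∀ X ∈ lowRank (I := I) r,
    (1 - δ) * ‖X‖ ^ 2 ≤ ‖F X‖ ^ 2 ∧ ‖F X‖ ^ 2 ≤ (1 + δ) * ‖X‖ ^ 2}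

/-- The tensor restricted isometry constant: the smallest admissible `δ`. (If the zero tensor is
the only one of multilinear rank at most `r`, every `δ` is admissible and the value is `0`.) -/
noncomputable def ripConstant {N : ℕ} {I : Fin N → ℕ} {p : ℕ}
    (F : Tensor I →ₗ[ℝ] EuclideanSpace ℝ (Fin p)) (r : Fin N → ℕ) : ℝ :=
  sInf (ripBounds F r)

/-- As soon as there is a nonzero tensor of multilinear rank at most `r`, the restricted isometry
constant is attained. -/
theorem isLeast_ripConstant {N : ℕ} {I : Fin N → ℕ} {p : ℕ}
    (F : Tensor I →ₗ[ℝ] EuclideanSpace ℝ (Fin p)) (r : Fin N → ℕ)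
    (h : ∃ X ∈ lowRank (I := I) r, X ≠ 0) : IsLeast (ripBounds F r) (ripConstant F r) := by
  obtain ⟨X₀, hX₀, hne⟩ := h
  have hclosed : IsClosed (ripBounds F r) := by
    have heq : ripBounds F r = ⋂ X ∈ lowRank (I := I) r,
        ({δ : ℝ | (1 - δ) * ‖X‖ ^ 2 ≤ ‖F X‖ ^ 2} ∩
          {δ : ℝ | ‖F X‖ ^ 2 ≤ (1 + δ) * ‖X‖ ^ 2}) := by
      ext δ
      simp [ripBounds]
    rw [heq]
    exact isClosed_biInter fun X _ => (isClosed_le (by fun_prop) (by fun_prop)).inter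
      (isClosed_le (by fun_prop) (by fun_prop))
  have hbdd : BddBelow (ripBounds F r) := by
    refine ⟨0, fun δ hδ => ?_⟩
    have h1 := hδ X₀ hX₀
    have h2 : 0 < ‖X₀‖ ^ 2 := by positivity
    nlinarith [h1.1, h1.2]
  have hnonempty : (ripBounds F r).Nonempty := by
    refine ⟨1 + ‖LinearMap.toContinuousLinearMap F‖ ^ 2, fun X _ => ?_⟩
    have h1 : ‖F X‖ ≤ ‖LinearMap.toContinuousLinearMap F‖ * ‖X‖ :=
      (LinearMap.toContinuousLinearMap F).le_opNorm X
    have h2 : ‖F X‖ ^ 2 ≤ (‖LinearMap.toContinuousLinearMap F‖ * ‖X‖) ^ 2 := by gcongr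
    constructor
    · nlinarith [sq_nonneg (‖LinearMap.toContinuousLinearMap F‖ * ‖X‖), sq_nonneg ‖F X‖]
    · nlinarith [sq_nonneg ‖X‖]
  exact ⟨hclosed.csInf_mem hnonempty hbdd, fun δ hδ => csInf_le hbdd hδ⟩

/-- The augmented objective `‖X‖_* + ‖X‖_F² / (2 α)`. -/
noncomputable def augmentedObjective {N : ℕ} {I : Fin N → ℕ} (α : ℝ) (X : Tensor I) : ℝ :=
  tensorTraceNorm X + 1 / (2 * α) * ‖X‖ ^ 2

/-- The set of solutions of the augmented model: the minimizers of the augmented objective among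
the tensors `X` with `F X = b`. -/
def augmentedSolutions {N : ℕ} {I : Fin N → ℕ} {p : ℕ} (α : ℝ)
    (F : Tensor I →ₗ[ℝ] EuclideanSpace ℝ (Fin p)) (b : EuclideanSpace ℝ (Fin p)) :
    Set (Tensor I) :=
  {X | F X = b ∧ ∀ Y : Tensor I, F Y = b → augmentedObjective α X ≤ augmentedObjective α Y}

end TensorRecovery

open TensorRecovery

/-! Every competitor is `X₀ + H` with `F H = 0`, and expanding `‖X₀ + H‖ ^ 2` reduces the claim to a
first-order inequality in each mode: for unfoldings `A` of `X₀` and `B` of `H`, `‖A‖_* ≤ ‖A + B‖_* +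
⟨A, B⟩ / α`. Averaging over the modes then leaves the surplus `‖H‖ ^ 2 / (2 * α)`, which gives
optimality and uniqueness together.

Let `ρ = rank A` and let `h` be the sum of the `ρ` largest singular values of `B`. Three facts give
the mode inequality. Perturbation (`sum_singularValues_add_ge`): `‖A + B‖_*` is at least `‖A‖_*`
plus the remaining singular values of `B` minus `h`. Duality (`abs_sum_inner_le`): `|⟨A, B⟩| ≤ ‖A‖₂
* h ≤ α * h / 10`. Null space property (`head_le_tail_of_ker`): the remaining singular values of `B`
sum to at least `1.1 * h`. The constants match because `1.1 = 1 + 1 / 10`.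

The null space property concerns only the singular values of `B`: rescaling them turns the
restricted isometry of `F` into one for weighted sequences (`head_le_tail_of_rip`). There the tail
is cut into blocks as long as the head, and each block is tested together with the head. -/

namespace TensorRecovery

open Module

/-! ### The null space inequality for weighted sequences -/

/-- The `ℓ²` norm of values in an interval `[a, b]` is controlled by their sum and by `b - a`. -/
theorem sum_sq_le_sq_of_mem_Icc {ι : Type*} (s : Finset ι) (x : ι → ℝ) {a b : ℝ} (ha : 0 ≤ a)
    (hs : 0 < s.card) (hx : ∀ i ∈ s, a ≤ x i ∧ x i ≤ b) :
    ∑ i ∈ s, x i ^ 2 ≤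
      ((∑ i ∈ s, x i) / √(s.card : ℝ) + √(s.card : ℝ) / 4 * (b - a)) ^ 2 := by
  set K : ℝ := (s.card : ℝ) with hK
  have hK0 : 0 < K := by rw [hK]; exact_mod_cast hs
  obtain ⟨i₀, hi₀⟩ := Finset.card_pos.1 hs
  have hab : a ≤ b := (hx i₀ hi₀).1.trans (hx i₀ hi₀).2
  -- This is `(x i - a) * (b - x i) ≥ 0`, summed.
  have h1 : ∑ i ∈ s, x i ^ 2 ≤ ∑ i ∈ s, ((a + b) * x i - a * b) :=
    Finset.sum_le_sum fun i hi => by nlinarith [hx i hi]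
  rw [Finset.sum_sub_distrib, ← Finset.mul_sum, Finset.sum_const, nsmul_eq_mul, ← hK] at h1
  set S := ∑ i ∈ s, x i
  have h2 : (S / √K + √K / 4 * (b - a)) ^ 2 = K * (S / K + (b - a) / 4) ^ 2 := by
    have hsq : √K ^ 2 = K := Real.sq_sqrt hK0.le
    have hs0 : 0 < √K := Real.sqrt_pos.2 hK0
    have h3 : S / √K + √K / 4 * (b - a) = √K * (S / K + (b - a) / 4) := by
      have : S / K = S / (√K * √K) := by rw [← sq, hsq]
      rw [this]
      field_simp
    rw [h3, mul_pow, hsq]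
  rw [h2]
  refine h1.trans ?_
  have h4 : S = K * (S / K) := by field_simp
  set m := S / K
  rw [h4]
  -- The difference of the two sides is `(m - (3 * a + b) / 4) ^ 2 + a * (b - a) / 2`.
  have h5 : (a + b) * m - a * b ≤ (m + (b - a) / 4) ^ 2 := by
    nlinarith [sq_nonneg (m - (3 * a + b) / 4), mul_nonneg ha (sub_nonneg.2 hab)]
  nlinarith [mul_le_mul_of_nonneg_left h5 hK0.le]

/-- Restricted isometry inequalities for a linear map on coefficient sequences, weighted by a
nonnegative decreasing sequence `σ`, force `σ` to have a heavy tail if the constant sequence `1`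
lies in the kernel. -/
theorem head_le_tail_of_rip {W : Type*} [NormedAddCommGroup W] [InnerProductSpace ℝ W]
    (Φ : (ℕ → ℝ) →ₗ[ℝ] W) {σ : ℕ → ℝ} (hσ : Antitone σ) (hσ0 : ∀ i, 0 ≤ σ i) {k : ℕ} (hk : 0 < k)
    (L : ℕ) {δ : ℝ} (hδ : δ < 0.4404)
    (hrip : ∀ (s : Finset ℕ) (a : ℕ → ℝ), s.card ≤ 2 * k → (∀ i ∉ s, a i = 0) →
      (1 - δ) * ∑ i ∈ s, (a i * σ i) ^ 2 ≤ ‖Φ a‖ ^ 2 ∧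
        ‖Φ a‖ ^ 2 ≤ (1 + δ) * ∑ i ∈ s, (a i * σ i) ^ 2)
    (hker : Φ (Set.indicator (Finset.range (k + k * L)) 1) = 0) :
    1.1 * ∑ i ∈ Finset.range k, σ i ≤ ∑ i ∈ Finset.Ico k (k + k * L), σ i := by
  by_contra! hcon
  set H := ∑ i ∈ Finset.range k, σ i with hH
  set S := ∑ i ∈ Finset.Ico k (k + k * L), σ i with hS
  set x := ∑ i ∈ Finset.range k, σ i ^ 2 with hx
  have hS0 : 0 ≤ S := Finset.sum_nonneg fun i _ => hσ0 i
  have hH0 : 0 < H := by linarith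
  set K : ℝ := (k : ℝ) with hK
  have hK0 : 0 < K := by rw [hK]; exact_mod_cast hk
  have hCS : H ^ 2 ≤ K * x := by
    simpa using sq_sum_le_card_mul_sum_sq (s := Finset.range k) (f := σ)
  have hx0 : 0 < x := by
    by_contra! h
    nlinarith [pow_pos hH0 2]
  set bl : ℕ → Finset ℕ := fun j => Finset.Ico (k + k * j) (k + k * (j + 1)) with hbl
  have hblcard : ∀ j, (bl j).card = k := fun j => by
    simp only [hbl, Nat.card_Ico, mul_add]; omega
  set b : ℕ → ℝ := fun j => σ (k + k * j) with hb
  set d : ℕ → ℝ := fun j => (∑ i ∈ bl j, σ i) / √K + √K / 4 * (b j - b (j + 1)) with hd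
  have hq : ∀ j, ∑ i ∈ bl j, σ i ^ 2 ≤ d j ^ 2 := fun j => by
    have := sum_sq_le_sq_of_mem_Icc (bl j) σ (a := b (j + 1)) (b := b j) (hσ0 _)
      (by rw [hblcard]; exact hk) (fun i hi => by
        simp only [hbl, Finset.mem_Ico] at hi
        exact ⟨hσ hi.2.le, hσ hi.1⟩)
    rwa [hblcard] at this
  have hd0 : ∀ j, 0 ≤ d j := fun j => by
    have h1 : b (j + 1) ≤ b j := hσ (by gcongr; omega)
    have h2 : 0 ≤ ∑ i ∈ bl j, σ i := Finset.sum_nonneg fun i _ => hσ0 i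
    have h3 : 0 ≤ b j - b (j + 1) := by linarith
    positivity
  have hSsum : ∀ L, ∑ j ∈ Finset.range L, ∑ i ∈ bl j, σ i
      = ∑ i ∈ Finset.Ico k (k + k * L), σ i := fun L => by
    induction L with
    | zero => simp
    | succ L ih =>
      rw [Finset.sum_range_succ, ih, hbl]
      exact Finset.sum_Ico_consecutive _ (by omega) (by gcongr; omega)
  -- The differences `b j - b (j + 1)` telescope to at most `b 0 ≤ H / K`, and `S < 1.1 * H` by
  -- contradiction hypothesis; hence `1.35 = 1.1 + 1 / 4`.
  have hD : ∑ j ∈ Finset.range L, d j ≤ 1.35 * √x := by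
    have h1 : ∑ j ∈ Finset.range L, d j = S / √K + √K / 4 * (b 0 - b L) := by
      simp only [hd]
      rw [Finset.sum_add_distrib, ← Finset.sum_div, ← Finset.mul_sum, hSsum,
        Finset.sum_range_sub']
    have h2 : K * b 0 ≤ H := by
      have := Finset.card_nsmul_le_sum (Finset.range k) σ (b 0) (fun i hi => hσ (by
        have := Finset.mem_range.1 hi
        omega))
      simpa using this
    have h3 : 0 ≤ b L := hσ0 _
    have hs0 : 0 < √K := Real.sqrt_pos.2 hK0
    have h4 : H ≤ √K * √x := by
      rw [← Real.sqrt_mul hK0.le]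
      exact Real.le_sqrt_of_sq_le hCS
    have hsq : √K * √K = K := Real.mul_self_sqrt hK0.le
    have h5 : √K * ∑ j ∈ Finset.range L, d j ≤ √K * (1.35 * √x) := by
      rw [h1]
      have : √K * (S / √K + √K / 4 * (b 0 - b L)) = S + (√K * √K) / 4 * (b 0 - b L) := by
        field_simp
      rw [this, hsq]
      nlinarith
    exact le_of_mul_le_mul_left h5 hs0
  set D := 1.35 * √x with hDdef
  have hDpos : 0 < D := by positivity
  have hDsq : D ^ 2 = 1.8225 * x := by
    rw [hDdef, mul_pow, Real.sq_sqrt hx0.le]; norm_num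
  set h : ℕ → ℝ := Set.indicator (Finset.range k) 1 with hh
  set w : ℕ → ℕ → ℝ := fun j => Set.indicator (bl j) 1 with hw
  have hsum : ∀ L, h + ∑ j ∈ Finset.range L, w j
      = Set.indicator (Finset.range (k + k * L)) 1 := fun L => by
    induction L with
    | zero => simp [hh]
    | succ L ih =>
      rw [Finset.sum_range_succ, ← add_assoc, ih, hw]
      ext i
      simp only [hbl, Pi.add_apply, Set.indicator_apply, Finset.coe_range, Set.mem_Iio,
        Finset.coe_Ico, Set.mem_Ico, Pi.one_apply]
      have : k + k * L ≤ k + k * (L + 1) := by gcongr; omega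
      split_ifs <;> first | omega | simp
  have hhw : Φ h + ∑ j ∈ Finset.range L, Φ (w j) = 0 := by
    rw [← map_sum, ← map_add, hsum, hker]
  have hX : (1 - δ) * x ≤ ‖Φ h‖ ^ 2 := by
    have := (hrip (Finset.range k) h (by simp; omega) (fun i hi => by
      simp only [hh]; rw [Set.indicator_of_notMem]; simpa using hi)).1
    refine le_trans (le_of_eq ?_) this
    congr 1
    exact Finset.sum_congr rfl fun i hi => by
      simp only [hh]; rw [Set.indicator_of_mem (by simpa using hi)]; simp
  -- The constant `0.4404` replaces `δ`, which may be negative, so that an upper bound on the block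
  -- energy can be inserted. Positivity is `4 * 0.5596 > 2 * 0.4404 * 1.8225`.
  set κ := 4 * (1 - δ) * x - 2 * 0.4404 * D ^ 2 with hκ
  have hκ0 : 0 < κ := by rw [hκ, hDsq]; nlinarith
  have hstep : ∀ j, d j / D * κ ≤ 4 * (d j / D) * ‖Φ h‖ ^ 2 + 4 * inner ℝ (Φ h) (Φ (w j)) := by
    intro j
    set q := ∑ i ∈ bl j, σ i ^ 2 with hqdef
    have hq0 : 0 ≤ q := Finset.sum_nonneg fun i _ => sq_nonneg _
    have hwup : ‖Φ (w j)‖ ^ 2 ≤ (1 + δ) * q := by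
      have := (hrip (bl j) (w j) (by rw [hblcard]; omega) (fun i hi => by
        simp only [hw]; rw [Set.indicator_of_notMem]; simpa using hi)).2
      refine le_trans this (le_of_eq ?_)
      congr 1
      exact Finset.sum_congr rfl fun i hi => by
        simp only [hw]; rw [Set.indicator_of_mem (by simpa using hi)]; simp
    -- With a coefficient `c * t` in place of `2 * t`, summation over the blocks would end in `(c ^
    -- 2 * τ - 2 * c) * ‖Φ h‖ ^ 2`, where `τ ≤ 1`; `c = 2` is the largest choice for which this is
    -- certainly nonpositive.
    have hlow : ∀ t : ℝ, (1 - δ) * (4 * t ^ 2 * x + q) ≤ ‖Φ ((2 * t) • h + w j)‖ ^ 2 := by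
      intro t
      have hdisj : Disjoint (Finset.range k) (bl j) := by
        rw [Finset.disjoint_left]
        intro i hi hi'
        simp only [hbl, Finset.mem_Ico, Finset.mem_range] at hi hi'
        omega
      have := (hrip (Finset.range k ∪ bl j) ((2 * t) • h + w j) (by
          rw [Finset.card_union_of_disjoint hdisj, hblcard]; simp; omega) (fun i hi => by
        rw [Finset.mem_union, not_or] at hi
        simp only [hw, hh, Pi.add_apply, Pi.smul_apply]
        rw [Set.indicator_of_notMem (by simpa using hi.1),
          Set.indicator_of_notMem (by simpa using hi.2)]
        simp)).1
      refine le_trans (le_of_eq ?_) this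
      congr 1
      rw [Finset.sum_union hdisj, hx, Finset.mul_sum]
      congr 1
      · refine Finset.sum_congr rfl fun i hi => ?_
        simp only [hw, hh, Pi.add_apply, Pi.smul_apply]
        rw [Set.indicator_of_mem (by simpa using hi),
          Set.indicator_of_notMem (by simpa using Finset.disjoint_left.1 hdisj hi)]
        simp; ring
      · refine Finset.sum_congr rfl fun i hi => ?_
        simp only [hw, hh, Pi.add_apply, Pi.smul_apply]
        rw [Set.indicator_of_notMem (by simpa using Finset.disjoint_right.1 hdisj hi),
          Set.indicator_of_mem (by simpa using hi)]
        simp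
    rcases (hd0 j).eq_or_lt with h0 | hpos
    · have hqz : q = 0 := le_antisymm (by simpa [← h0] using hq j) hq0
      have : Φ (w j) = 0 := by
        rw [hqz, mul_zero] at hwup
        exact norm_eq_zero.1 (pow_eq_zero_iff (two_ne_zero) |>.1
          (le_antisymm hwup (sq_nonneg _)))
      simp [← h0, this]
    · set t := d j / D with ht
      have ht0 : 0 < t := by positivity
      have h1 := hlow t
      rw [map_add, map_smul, norm_add_sq_real, norm_smul, inner_smul_left, mul_pow] at h1
      simp only [Real.norm_eq_abs, sq_abs, conj_trivial] at h1
      have h2 : q ≤ t ^ 2 * D ^ 2 := by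
        have : d j = t * D := by rw [ht]; field_simp
        rw [← mul_pow, ← this]; exact hq j
      have h3 : t * (t * κ) ≤ t * (4 * t * ‖Φ h‖ ^ 2 + 4 * inner ℝ (Φ h) (Φ (w j))) := by
        rw [hκ]
        nlinarith
      exact le_of_mul_le_mul_left h3 ht0
  -- The block images sum to `-Φ h`, so the total reads `τ * κ ≤ 4 * (τ - 1) * ‖Φ h‖ ^ 2` with `0 ≤
  -- τ ≤ 1`. This forces `τ = 0` and then `‖Φ h‖ = 0`, against the lower isometry bound.
  have htot := Finset.sum_le_sum fun j (_ : j ∈ Finset.range L) => hstep j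
  rw [Finset.sum_add_distrib, ← Finset.sum_mul, ← Finset.sum_mul, ← Finset.mul_sum,
    ← Finset.mul_sum, ← inner_sum, eq_neg_of_add_eq_zero_right hhw, inner_neg_right,
    real_inner_self_eq_norm_sq, ← Finset.sum_div] at htot
  set τ := (∑ j ∈ Finset.range L, d j) / D with hτ
  have hτ0 : 0 ≤ τ := div_nonneg (Finset.sum_nonneg fun j _ => hd0 j) hDpos.le
  have hτ1 : τ ≤ 1 := (div_le_one hDpos).2 hD
  have hXpos : 0 < ‖Φ h‖ ^ 2 := lt_of_lt_of_le (by nlinarith) hX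
  have hτz : τ * κ ≤ 0 := by nlinarith
  have : τ = 0 := le_antisymm (by by_contra! hh; nlinarith [mul_pos hh hκ0]) hτ0
  rw [this] at htot
  linarith

/-! ### Eigenvalue bounds and singular vectors -/

section Spectral

variable {E F : Type*} [NormedAddCommGroup E] [InnerProductSpace ℝ E] [FiniteDimensional ℝ E]
  [NormedAddCommGroup F] [InnerProductSpace ℝ F] [FiniteDimensional ℝ F]

theorem inner_self_eq_sum_eigenvalues {T : E →ₗ[ℝ] E} (hT : T.IsSymmetric) {n : ℕ}
    (hn : finrank ℝ E = n) (x : E) :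
    inner ℝ x (T x) = ∑ i, hT.eigenvalues hn i * inner ℝ (hT.eigenvectorBasis hn i) x ^ 2 := by
  rw [← (hT.eigenvectorBasis hn).sum_inner_mul_inner]
  refine Finset.sum_congr rfl fun i _ => ?_
  rw [← hT, hT.apply_eigenvectorBasis, inner_smul_left, real_inner_comm]
  simp; ring

/-- The easy half of the Courant–Fischer principle. -/
theorem le_eigenvalues_of_injective {T : E →ₗ[ℝ] E} (hT : T.IsSymmetric) {n : ℕ}
    (hn : finrank ℝ E = n) (i : Fin n) {V : Type*} [AddCommGroup V] [Module ℝ V]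
    [FiniteDimensional ℝ V] (f : V →ₗ[ℝ] E) (hf : Function.Injective f)
    (hV : (i : ℕ) < finrank ℝ V) {c : ℝ} (hc : ∀ v, c * ‖f v‖ ^ 2 ≤ inner ℝ (f v) (T (f v))) :
    c ≤ hT.eigenvalues hn i := by
  set e := hT.eigenvectorBasis hn
  -- Only `i` conditions are imposed on a space of dimension greater than `i`, so some nonzero
  -- vector is orthogonal to the leading `i` eigenvectors and meets only eigenvalues up to the
  -- `i`-th.
  let g : V →ₗ[ℝ] (Fin i → ℝ) :=
    LinearMap.pi fun j => (innerₛₗ ℝ (e ⟨j, j.2.trans i.2⟩)) ∘ₗ f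
  have hg : LinearMap.ker g ≠ ⊥ := LinearMap.ker_ne_bot_of_finrank_lt (by simpa using hV)
  obtain ⟨v, hv, hv0⟩ := Submodule.exists_mem_ne_zero_of_ne_bot hg
  have hfv : f v ≠ 0 := fun h => hv0 (hf (by simpa using h))
  have horth : ∀ j : Fin n, j < i → inner ℝ (e j) (f v) = 0 := fun j hj =>
    congrFun (LinearMap.mem_ker.1 hv) ⟨j, hj⟩
  have h1 := hc v
  rw [inner_self_eq_sum_eigenvalues hT hn] at h1
  have h2 : ∑ j, hT.eigenvalues hn j * inner ℝ (e j) (f v) ^ 2 ≤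
      ∑ j, hT.eigenvalues hn i * inner ℝ (e j) (f v) ^ 2 := by
    refine Finset.sum_le_sum fun j _ => ?_
    rcases lt_or_ge j i with hj | hj
    · simp [horth j hj]
    · exact mul_le_mul_of_nonneg_right (hT.eigenvalues_antitone hn hj) (sq_nonneg _)
  have h3 : ∑ j, inner ℝ (e j) (f v) ^ 2 = ‖f v‖ ^ 2 := by
    rw [← e.sum_sq_norm_inner_right]; simp
  rw [← Finset.mul_sum, h3] at h2
  exact le_of_mul_le_mul_right (h1.trans h2) (by positivity)

/-- The codimension form of the same principle: by rank–nullity the kernel has dimension greater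
than `i`. -/
theorem le_eigenvalues_of_ker {T : E →ₗ[ℝ] E} (hT : T.IsSymmetric) {n : ℕ}
    (hn : finrank ℝ E = n) (i : Fin n) {V : Type*} [AddCommGroup V] [Module ℝ V]
    [FiniteDimensional ℝ V] (f : E →ₗ[ℝ] V) (hV : (i : ℕ) + finrank ℝ V < n) {c : ℝ}
    (hc : ∀ x, f x = 0 → c * ‖x‖ ^ 2 ≤ inner ℝ x (T x)) :
    c ≤ hT.eigenvalues hn i := by
  refine le_eigenvalues_of_injective hT hn i (LinearMap.ker f).subtype
    (Submodule.subtype_injective _) ?_ fun v => hc v (LinearMap.mem_ker.1 v.2)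
  have h1 := LinearMap.finrank_range_add_finrank_ker f
  have h2 := Submodule.finrank_le (LinearMap.range f)
  omega

/-- A basis of right singular vectors of a linear map. -/
noncomputable def rightSingularBasis (T : E →ₗ[ℝ] F) : OrthonormalBasis (Fin (finrank ℝ E)) ℝ E :=
  T.isSymmetric_adjoint_comp_self.eigenvectorBasis rfl

theorem inner_map_map_rightSingularBasis (T : E →ₗ[ℝ] F) (i : Fin (finrank ℝ E)) (x : E) :
    inner ℝ (T x) (T (rightSingularBasis T i)) =
      T.singularValues i ^ 2 * inner ℝ x (rightSingularBasis T i) := by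
  rw [← LinearMap.adjoint_inner_right, ← LinearMap.comp_apply, rightSingularBasis,
    T.isSymmetric_adjoint_comp_self.apply_eigenvectorBasis, inner_smul_right,
    T.sq_singularValues_fin rfl]
  rfl

theorem inner_map_map_rightSingularBasis_eq_ite (T : E →ₗ[ℝ] F) (i j : Fin (finrank ℝ E)) :
    inner ℝ (T (rightSingularBasis T i)) (T (rightSingularBasis T j)) =
      if i = j then T.singularValues i ^ 2 else 0 := by
  rw [inner_map_map_rightSingularBasis, (rightSingularBasis T).inner_eq_ite]
  split_ifs with h <;> simp [h]

theorem norm_map_rightSingularBasis (T : E →ₗ[ℝ] F) (i : Fin (finrank ℝ E)) :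
    ‖T (rightSingularBasis T i)‖ = T.singularValues i := by
  have := inner_map_map_rightSingularBasis_eq_ite T i i
  rw [real_inner_self_eq_norm_sq, if_pos rfl] at this
  exact (sq_eq_sq₀ (norm_nonneg _) (T.singularValues_nonneg _)).1 this

theorem norm_map_sq_eq_sum (T : E →ₗ[ℝ] F) (x : E) :
    ‖T x‖ ^ 2 = ∑ i : Fin (finrank ℝ E),
      T.singularValues i ^ 2 * inner ℝ (rightSingularBasis T i) x ^ 2 := by
  rw [← real_inner_self_eq_norm_sq, ← LinearMap.adjoint_inner_right, ← LinearMap.comp_apply,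
    inner_self_eq_sum_eigenvalues T.isSymmetric_adjoint_comp_self rfl]
  simp_rw [T.sq_singularValues_fin rfl]
  rfl

/-- Only singular values of index at least `l` act on such an `x`, and `T.singularValues l`
dominates them all. -/
theorem norm_map_le_of_inner_eq_zero (T : E →ₗ[ℝ] F) (l : ℕ) {x : E}
    (hx : ∀ i : Fin (finrank ℝ E), (i : ℕ) < l → inner ℝ (rightSingularBasis T i) x = 0) :
    ‖T x‖ ≤ T.singularValues l * ‖x‖ := by
  refine le_of_sq_le_sq ?_ (mul_nonneg (T.singularValues_nonneg _) (norm_nonneg _))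
  rw [norm_map_sq_eq_sum, mul_pow, ← (rightSingularBasis T).sum_sq_norm_inner_right x,
    Finset.mul_sum]
  refine Finset.sum_le_sum fun i _ => ?_
  rcases lt_or_ge (i : ℕ) l with h | h
  · simp [hx i h]
  · rw [Real.norm_eq_abs, sq_abs]
    have := T.singularValues_nonneg i
    gcongr
    exact T.singularValues_antitone h

theorem norm_map_le_singularValues_zero (T : E →ₗ[ℝ] F) (x : E) :
    ‖T x‖ ≤ T.singularValues 0 * ‖x‖ :=
  norm_map_le_of_inner_eq_zero T 0 fun _ h => absurd h (Nat.not_lt_zero _)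

theorem singularValues_neg (T : E →ₗ[ℝ] F) : (-T).singularValues = T.singularValues := by
  have h : LinearMap.adjoint (-T) ∘ₗ (-T) = LinearMap.adjoint T ∘ₗ T := by
    rw [map_neg, LinearMap.neg_comp, LinearMap.comp_neg, neg_neg]
  unfold LinearMap.singularValues
  simp only [h]

/-- Left singular vectors of a linear map, with value zero where the singular value vanishes. -/
noncomputable def leftSingularVector (T : E →ₗ[ℝ] F) (i : Fin (finrank ℝ E)) : F :=
  (T.singularValues i)⁻¹ • T (rightSingularBasis T i)

theorem map_rightSingularBasis (T : E →ₗ[ℝ] F) (i : Fin (finrank ℝ E)) :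
    T (rightSingularBasis T i) = T.singularValues i • leftSingularVector T i := by
  rw [leftSingularVector, smul_smul]
  rcases eq_or_ne (T.singularValues i) 0 with h | h
  · rw [h, zero_mul, zero_smul, ← norm_eq_zero, norm_map_rightSingularBasis, h]
  · rw [mul_inv_cancel₀ h, one_smul]

theorem norm_leftSingularVector_le (T : E →ₗ[ℝ] F) (i : Fin (finrank ℝ E)) :
    ‖leftSingularVector T i‖ ≤ 1 := by
  rw [leftSingularVector, norm_smul, norm_map_rightSingularBasis, norm_inv, Real.norm_eq_abs,
    abs_of_nonneg (T.singularValues_nonneg _)]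
  exact inv_mul_le_one

theorem map_eq_sum (T : E →ₗ[ℝ] F) (x : E) :
    T x = ∑ i : Fin (finrank ℝ E), (T.singularValues i * inner ℝ (rightSingularBasis T i) x) •
      leftSingularVector T i := by
  conv_lhs => rw [← (rightSingularBasis T).sum_repr' x, map_sum]
  refine Finset.sum_congr rfl fun i _ => ?_
  rw [map_smul, map_rightSingularBasis, smul_smul, mul_comm]

theorem inner_leftSingularVector_eq_ite (T : E →ₗ[ℝ] F) (i j : Fin (finrank ℝ E)) :
    inner ℝ (leftSingularVector T i) (leftSingularVector T j) =
      if i = j ∧ T.singularValues i ≠ 0 then (1 : ℝ) else 0 := by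
  rw [leftSingularVector, leftSingularVector, inner_smul_left, inner_smul_right,
    inner_map_map_rightSingularBasis_eq_ite]
  by_cases hij : i = j
  · subst hij
    by_cases h : T.singularValues i = 0
    · simp [h]
    · simp [h]; field_simp
  · simp [hij]

/-- Bessel's inequality for the left singular vectors. -/
theorem sum_inner_leftSingularVector_sq_le (T : E →ₗ[ℝ] F) (y : F) :
    ∑ i, inner ℝ (leftSingularVector T i) y ^ 2 ≤ ‖y‖ ^ 2 := by
  set z := ∑ i, inner ℝ (leftSingularVector T i) y • leftSingularVector T i with hz
  set s := ∑ i, inner ℝ (leftSingularVector T i) y ^ 2 with hs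
  have h1 : inner ℝ z y = s := by
    rw [hz, sum_inner]
    exact Finset.sum_congr rfl fun i _ => by rw [inner_smul_left]; simp [sq]
  have h2 : inner ℝ z z = s := by
    rw [hz, sum_inner]
    refine Finset.sum_congr rfl fun i _ => ?_
    rw [inner_sum, Finset.sum_eq_single i]
    · rw [inner_smul_left, inner_smul_right, inner_leftSingularVector_eq_ite]
      by_cases h : T.singularValues i = 0
      · simp [h, leftSingularVector]
      · simp [h, sq]
    · intro j _ hj
      rw [inner_smul_left, inner_smul_right, inner_leftSingularVector_eq_ite]
      simp [Ne.symm hj]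
    · simp
  have h3 : 0 ≤ ‖y - z‖ ^ 2 := sq_nonneg _
  rw [norm_sub_sq_real, real_inner_comm, h1, ← real_inner_self_eq_norm_sq z, h2] at h3
  linarith

end Spectral

/-! ### Trace norm perturbation and trace duality through the self-adjoint dilation -/

section Mirsky

variable {E F : Type*} [NormedAddCommGroup E] [InnerProductSpace ℝ E] [FiniteDimensional ℝ E]
  [NormedAddCommGroup F] [InnerProductSpace ℝ F] [FiniteDimensional ℝ F]

/-- The operator `∑ (σᵢ / 2) wᵢ wᵢᵀ` with `wᵢ = (vᵢ, uᵢ)` built from the singular vectors of `C`: the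
positive part of the self-adjoint dilation of `C`. -/
noncomputable def dilationPosPart (C : E →ₗ[ℝ] F) : WithLp 2 (E × F) →ₗ[ℝ] WithLp 2 (E × F) :=
  ∑ i : Fin (finrank ℝ E), (C.singularValues i / 2) •
    (innerₛₗ ℝ (WithLp.toLp 2 (rightSingularBasis C i, leftSingularVector C i))).smulRight
      (WithLp.toLp 2 (rightSingularBasis C i, leftSingularVector C i))

/-- The self-adjoint dilation of a linear map. -/
noncomputable def dilation (B : E →ₗ[ℝ] F) : WithLp 2 (E × F) →ₗ[ℝ] WithLp 2 (E × F) where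
  toFun z := WithLp.toLp 2 (LinearMap.adjoint B z.snd, B z.fst)
  map_add' x y := by simp [← WithLp.toLp_add]
  map_smul' c x := by simp [← WithLp.toLp_smul]

theorem dilationPosPart_inner (C : E →ₗ[ℝ] F) (x y : WithLp 2 (E × F)) :
    inner ℝ x (dilationPosPart C y) = ∑ i : Fin (finrank ℝ E), C.singularValues i / 2 *
      (inner ℝ (WithLp.toLp 2 (rightSingularBasis C i, leftSingularVector C i)) x *
        inner ℝ (WithLp.toLp 2 (rightSingularBasis C i, leftSingularVector C i)) y) := by
  rw [dilationPosPart, LinearMap.sum_apply, inner_sum]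
  refine Finset.sum_congr rfl fun i _ => ?_
  rw [LinearMap.smul_apply, LinearMap.smulRight_apply, inner_smul_right, inner_smul_right,
    real_inner_comm]
  simp only [innerₛₗ_apply_apply]
  ring

theorem dilation_inner (B : E →ₗ[ℝ] F) (x y : WithLp 2 (E × F)) :
    inner ℝ x (dilation B y) = inner ℝ (B x.fst) y.snd + inner ℝ x.snd (B y.fst) := by
  rw [WithLp.prod_inner_apply]
  change inner ℝ x.fst (LinearMap.adjoint B y.snd) + inner ℝ x.snd (B y.fst) = _
  rw [LinearMap.adjoint_inner_right]

theorem isSymmetric_dilationPosPart_sub_dilation (B C : E →ₗ[ℝ] F) :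
    (dilationPosPart C - dilation B).IsSymmetric := by
  intro x y
  rw [real_inner_comm, LinearMap.sub_apply, LinearMap.sub_apply, inner_sub_right, inner_sub_right,
    dilationPosPart_inner, dilationPosPart_inner, dilation_inner, dilation_inner,
    real_inner_comm x.snd, real_inner_comm y.snd, add_comm]
  congr 1
  exact Finset.sum_congr rfl fun i _ => by ring

/-- The dilation has zero diagonal blocks, hence zero trace. A rank-one term of the positive part
has trace `σᵢ / 2 * (‖vᵢ‖ ^ 2 + ‖uᵢ‖ ^ 2) ≤ σᵢ`; strictness can occur only where `uᵢ = 0`. -/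
theorem trace_dilationPosPart_sub_dilation_le (B C : E →ₗ[ℝ] F) :
    LinearMap.trace ℝ _ (dilationPosPart C - dilation B) ≤
      ∑ i : Fin (finrank ℝ E), C.singularValues i := by
  set b := (stdOrthonormalBasis ℝ E).prod (stdOrthonormalBasis ℝ F)
  rw [map_sub, LinearMap.trace_eq_sum_inner (dilation B) b]
  have h1 : ∑ i, inner ℝ (b i) (dilation B (b i)) = 0 := by
    refine Finset.sum_eq_zero fun i _ => ?_
    rw [dilation_inner]
    rcases i with i | i <;> simp [b]
  rw [h1, sub_zero, LinearMap.trace_eq_sum_inner _ b]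
  simp_rw [dilationPosPart_inner]
  rw [Finset.sum_comm]
  refine Finset.sum_le_sum fun i _ => ?_
  rw [← Finset.mul_sum]
  have h2 := b.sum_sq_norm_inner_left
    (WithLp.toLp 2 (rightSingularBasis C i, leftSingularVector C i))
  simp only [Real.norm_eq_abs, sq_abs] at h2
  simp_rw [← sq]
  rw [h2, WithLp.prod_norm_sq_eq_of_L2]
  change _ * (‖rightSingularBasis C i‖ ^ 2 + ‖leftSingularVector C i‖ ^ 2) ≤ _
  rw [OrthonormalBasis.norm_eq_one]
  have h3 : ‖leftSingularVector C i‖ ^ 2 ≤ 1 :=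
    pow_le_one₀ (norm_nonneg _) (norm_leftSingularVector_le C i)
  have h4 := C.singularValues_nonneg i
  nlinarith

/-- Termwise, the gap is `σᵢ / 2 * (p - q) ^ 2`, where `p` and `q` are the coordinates of `x.fst`
along `vᵢ` and of `x.snd` along `uᵢ`. -/
theorem inner_dilation_self_le (C : E →ₗ[ℝ] F) (x : WithLp 2 (E × F)) :
    2 * inner ℝ x.snd (C x.fst) ≤ inner ℝ x (dilationPosPart C x) := by
  rw [dilationPosPart_inner, map_eq_sum C x.fst, inner_sum, Finset.mul_sum]
  refine Finset.sum_le_sum fun i _ => ?_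
  rw [inner_smul_right, WithLp.prod_inner_apply, real_inner_comm (leftSingularVector C i)]
  have h4 := C.singularValues_nonneg i
  set p := inner ℝ (rightSingularBasis C i) x.fst
  set q := inner ℝ (leftSingularVector C i) x.snd
  change _ ≤ C.singularValues i / 2 * ((p + q) * (p + q))
  nlinarith [mul_nonneg h4 (sq_nonneg (p - q))]

theorem inner_dilationPosPart_nonneg (C : E →ₗ[ℝ] F) (x : WithLp 2 (E × F)) :
    0 ≤ inner ℝ x (dilationPosPart C x) := by
  rw [dilationPosPart_inner]
  exact Finset.sum_nonneg fun i _ =>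
    mul_nonneg (div_nonneg (C.singularValues_nonneg _) zero_le_two) (mul_self_nonneg _)

/-- An operator dominating the dilation of `T` has eigenvalues at least the singular values
of `T`. -/
theorem singularValues_le_eigenvalues (T : E →ₗ[ℝ] F)
    {M : WithLp 2 (E × F) →ₗ[ℝ] WithLp 2 (E × F)} (hM : M.IsSymmetric) {n : ℕ}
    (hn : finrank ℝ (WithLp 2 (E × F)) = n) (i : Fin n) (hi : (i : ℕ) < finrank ℝ T.range)
    (h : ∀ x, 2 * inner ℝ x.snd (T x.fst) ≤ inner ℝ x (M x)) :
    T.singularValues i ≤ hM.eigenvalues hn i := by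
  have hrE : finrank ℝ T.range ≤ finrank ℝ E := LinearMap.finrank_range_le T
  let ι : Fin (i + 1) → Fin (finrank ℝ E) := fun j => ⟨j, by omega⟩
  have hι : Function.Injective ι := fun a b hab => Fin.ext (Fin.mk.inj_iff.1 hab)
  have hσ : ∀ j, T.singularValues (ι j) ≠ 0 := fun j =>
    (T.singularValues_pos_iff_lt_finrank_range.2 (by simp [ι]; omega)).ne'
  have hv : Orthonormal ℝ (rightSingularBasis T ∘ ι) :=
    (rightSingularBasis T).orthonormal.comp ι hι
  have hu : Orthonormal ℝ (leftSingularVector T ∘ ι) := by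
    rw [orthonormal_iff_ite]
    intro a b
    rw [Function.comp_apply, Function.comp_apply, inner_leftSingularVector_eq_ite]
    simp [hσ, hι.eq_iff]
  -- The span of the pairs `(vⱼ, uⱼ)`, `j ≤ i`. Since `i` is below the rank, the `uⱼ` are
  -- orthonormal too, so `‖f c‖ ^ 2 = 2 * ‖c‖ ^ 2`, which absorbs the factor `2` in the form.
  let f : EuclideanSpace ℝ (Fin (i + 1)) →ₗ[ℝ] WithLp 2 (E × F) :=
    { toFun := fun c => WithLp.toLp 2
        (∑ j, c j • (rightSingularBasis T ∘ ι) j, ∑ j, c j • (leftSingularVector T ∘ ι) j)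
      map_add' := fun c d => by
        simp [← WithLp.toLp_add, add_smul, Finset.sum_add_distrib]
      map_smul' := fun c d => by
        simp [← WithLp.toLp_smul, mul_smul, Finset.smul_sum] }
  have hfst : ∀ c, ‖(f c).fst‖ ^ 2 = ‖c‖ ^ 2 := fun c => by
    rw [← real_inner_self_eq_norm_sq, EuclideanSpace.real_norm_sq_eq]
    change inner ℝ (∑ j, c j • _) (∑ j, c j • _) = _
    rw [hv.inner_sum]
    simp [sq]
  have hsnd : ∀ c, ‖(f c).snd‖ ^ 2 = ‖c‖ ^ 2 := fun c => by
    rw [← real_inner_self_eq_norm_sq, EuclideanSpace.real_norm_sq_eq]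
    change inner ℝ (∑ j, c j • _) (∑ j, c j • _) = _
    rw [hu.inner_sum]
    simp [sq]
  refine le_eigenvalues_of_injective hM hn i f ?_ (by simp) fun c => ?_
  · rw [injective_iff_map_eq_zero]
    intro c hc
    have := hfst c
    rw [hc] at this
    simpa using this.symm
  · refine le_trans ?_ (h (f c))
    have hT : T (f c).fst = ∑ j, (T.singularValues (ι j) * c j) • (leftSingularVector T ∘ ι) j := by
      change T (∑ j, c j • _) = _
      rw [map_sum]
      refine Finset.sum_congr rfl fun j _ => ?_
      rw [map_smul, Function.comp_apply, map_rightSingularBasis, smul_smul, mul_comm]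
      rfl
    have h2 : inner ℝ (f c).snd (T (f c).fst) = ∑ j, T.singularValues (ι j) * c j ^ 2 := by
      rw [hT]
      change inner ℝ (∑ j, c j • _) _ = _
      rw [hu.inner_sum]
      exact Finset.sum_congr rfl fun j _ => by simp; ring
    rw [h2, WithLp.prod_norm_sq_eq_of_L2, hfst, hsnd, EuclideanSpace.real_norm_sq_eq, ← two_mul,
      mul_left_comm, Finset.mul_sum]
    refine mul_le_mul_of_nonneg_left (Finset.sum_le_sum fun j _ => ?_) zero_le_two
    refine mul_le_mul_of_nonneg_right (T.singularValues_antitone ?_) (sq_nonneg _)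
    simp [ι]; omega

/-- Mirsky's perturbation inequality for the trace norm, when one of the operators has small
rank. -/
theorem sum_singularValues_add_ge (A B : E →ₗ[ℝ] F) :
    ∑ i ∈ Finset.range (finrank ℝ A.range), A.singularValues i +
        ∑ i ∈ Finset.Ico (finrank ℝ A.range) (finrank ℝ E), B.singularValues i ≤
      ∑ i ∈ Finset.range (finrank ℝ E), (A + B).singularValues i +
        ∑ i ∈ Finset.range (finrank ℝ A.range), B.singularValues i := by
  -- As the positive part dominates both the dilation of `A + B` and zero, `M` dominates the
  -- dilation of `A` and that of `-B`, while its trace is at most the trace norm of `A + B`.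
  set M := dilationPosPart (A + B) - dilation B with hMdef
  have hM : M.IsSymmetric := isSymmetric_dilationPosPart_sub_dilation B (A + B)
  set ρ := finrank ℝ A.range with hρ
  have hρE : ρ ≤ finrank ℝ E := LinearMap.finrank_range_le A
  have hρF : ρ ≤ finrank ℝ F := Submodule.finrank_le _
  have hD : finrank ℝ (WithLp 2 (E × F)) = finrank ℝ E + finrank ℝ F := by
    rw [(WithLp.linearEquiv 2 ℝ (E × F)).finrank_eq, finrank_prod]
  set D := finrank ℝ E + finrank ℝ F with hDdef
  have hform : ∀ x, inner ℝ x (M x) =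
      inner ℝ x (dilationPosPart (A + B) x) - 2 * inner ℝ x.snd (B x.fst) := fun x => by
    rw [hMdef, LinearMap.sub_apply, inner_sub_right, dilation_inner, real_inner_comm x.snd]
    ring
  have hA : ∀ x, 2 * inner ℝ x.snd (A x.fst) ≤ inner ℝ x (M x) := fun x => by
    have := inner_dilation_self_le (A + B) x
    rw [LinearMap.add_apply, inner_add_right] at this
    rw [hform]
    linarith
  have hB : ∀ x, -(2 * inner ℝ x.snd (B x.fst)) ≤ inner ℝ x (M x) := fun x => by
    have := inner_dilationPosPart_nonneg (A + B) x
    rw [hform]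
    linarith
  -- Lower bounds for the eigenvalues of `M`: comparison with `A` for the top `ρ`, with `-B` below;
  -- the last `ρ` are bounded by the negative eigenvalues of the dilation of `-B`.
  set g : ℕ → ℝ := fun i => if i < ρ then A.singularValues i else
    if i < D - ρ then B.singularValues i else -B.singularValues (D - 1 - i) with hg
  have hle : ∀ i : Fin D, g i ≤ hM.eigenvalues hD i := by
    intro i
    simp only [hg]
    split_ifs with h1 h2
    · exact singularValues_le_eigenvalues A hM hD i h1 hA
    · rcases lt_or_ge (i : ℕ) (finrank ℝ B.range) with h3 | h3
      · rw [← singularValues_neg]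
        refine singularValues_le_eigenvalues (-B) hM hD i (by rwa [LinearMap.range_neg]) fun x => ?_
        simpa using hB x
      · rw [B.singularValues_eq_zero_iff_le_finrank_range.2 h3]
        -- Where `B` contributes zero, nonnegativity comes from `A`: its dilation form vanishes when
        -- `x.snd` lies in the kernel of the adjoint. That condition is written as `A (adjoint A
        -- x.snd) = 0` with values in the range of `A`, so that it costs only `ρ` dimensions.
        refine le_eigenvalues_of_ker hM hD i (A.rangeRestrict ∘ₗ LinearMap.adjoint A ∘ₗ
          LinearMap.snd ℝ E F ∘ₗ (WithLp.linearEquiv 2 ℝ (E × F)).toLinearMap) (by omega)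
          fun x hx => ?_
        have hx' : A (LinearMap.adjoint A x.snd) = 0 := congrArg Subtype.val hx
        have hx2 : LinearMap.adjoint A x.snd = 0 := by
          rw [← inner_self_eq_zero (𝕜 := ℝ), LinearMap.adjoint_inner_left, hx', inner_zero_right]
        have := hA x
        rw [← LinearMap.adjoint_inner_left, hx2, inner_zero_left] at this
        simpa using this
    · set l := D - 1 - (i : ℕ) with hl
      have hlρ : l < ρ := by omega
      -- Orthogonality of `x.fst` to the first `l` right singular vectors of `B` costs `l`
      -- dimensions, and `i + l = D - 1 < D`.
      refine le_eigenvalues_of_ker hM hD i (LinearMap.pi (fun j : Fin l =>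
          innerₛₗ ℝ (rightSingularBasis B ⟨j, by omega⟩)) ∘ₗ
          LinearMap.fst ℝ E F ∘ₗ (WithLp.linearEquiv 2 ℝ (E × F)).toLinearMap)
          (by simp; omega) fun x hx => ?_
      refine le_trans ?_ (hB x)
      have h3 : ‖B x.fst‖ ≤ B.singularValues l * ‖x.fst‖ :=
        norm_map_le_of_inner_eq_zero B l fun j hj => congrFun hx ⟨j, hj⟩
      have h4 := real_inner_le_norm x.snd (B x.fst)
      have h5 := B.singularValues_nonneg l
      rw [WithLp.prod_norm_sq_eq_of_L2]
      have h6 := mul_le_mul_of_nonneg_left h3 (norm_nonneg x.snd)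
      nlinarith [mul_nonneg h5 (sq_nonneg (‖x.fst‖ - ‖x.snd‖))]
  have htr : ∑ i : Fin D, hM.eigenvalues hD i ≤
      ∑ i : Fin (finrank ℝ E), (A + B).singularValues i := by
    refine le_trans (le_of_eq ?_) (trace_dilationPosPart_sub_dilation_le B (A + B))
    rw [LinearMap.trace_eq_sum_inner _ (hM.eigenvectorBasis hD)]
    refine Finset.sum_congr rfl fun i _ => ?_
    rw [← hMdef, hM.apply_eigenvectorBasis, inner_smul_right, real_inner_self_eq_norm_sq]
    simp
  have hsum := (Finset.sum_le_sum fun i (_ : i ∈ Finset.univ) => hle i).trans htr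
  rw [Fin.sum_univ_eq_sum_range g, Fin.sum_univ_eq_sum_range (fun i => (A + B).singularValues i),
    ← Finset.sum_range_add_sum_Ico g (show ρ ≤ D by omega),
    ← Finset.sum_Ico_consecutive g (show ρ ≤ D - ρ by omega) (show D - ρ ≤ D by omega)] at hsum
  have e1 : ∑ i ∈ Finset.range ρ, g i = ∑ i ∈ Finset.range ρ, A.singularValues i :=
    Finset.sum_congr rfl fun i hi => if_pos (Finset.mem_range.1 hi)
  -- Here `ρ ≤ finrank ℝ F` gives `finrank ℝ E ≤ D - ρ`.
  have e2 : ∑ i ∈ Finset.Ico ρ (finrank ℝ E), B.singularValues i ≤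
      ∑ i ∈ Finset.Ico ρ (D - ρ), g i := by
    have : ∑ i ∈ Finset.Ico ρ (D - ρ), g i =
        ∑ i ∈ Finset.Ico ρ (D - ρ), B.singularValues i :=
      Finset.sum_congr rfl fun i hi => by
        rw [Finset.mem_Ico] at hi
        simp only [hg]
        rw [if_neg (by omega), if_pos hi.2]
    rw [this]
    exact Finset.sum_le_sum_of_subset_of_nonneg (Finset.Ico_subset_Ico_right (by omega))
      fun i _ _ => B.singularValues_nonneg i
  have e3 : ∑ i ∈ Finset.Ico (D - ρ) D, g i = -∑ i ∈ Finset.range ρ, B.singularValues i := by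
    rw [Finset.sum_Ico_eq_sum_range, show D - (D - ρ) = ρ by omega,
      ← Finset.sum_range_reflect, ← Finset.sum_neg_distrib]
    refine Finset.sum_congr rfl fun i hi => ?_
    rw [Finset.mem_range] at hi
    simp only [hg]
    rw [if_neg (by omega), if_neg (by omega)]
    congr 2
    omega
  linarith

/-- Bathtub principle: a capped mass is best placed on the largest weights. Termwise, `σ i - σ k`
and `c i - s * 1_{i < k}` have opposite signs. -/
theorem sum_mul_le_mul_sum_range {n k : ℕ} (hk : k ≤ n) {σ : ℕ → ℝ} (hσ : Antitone σ)
    (hσ0 : ∀ i, 0 ≤ σ i) {c : Fin n → ℝ} {s : ℝ} (hc0 : ∀ i, 0 ≤ c i) (hcs : ∀ i, c i ≤ s)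
    (hc : ∑ i, c i ≤ k * s) :
    ∑ i : Fin n, σ i * c i ≤ s * ∑ i ∈ Finset.range k, σ i := by
  have h1 : ∀ f : ℕ → ℝ, ∑ i : Fin n, (if (i : ℕ) < k then f i else 0) =
      ∑ i ∈ Finset.range k, f i := fun f => by
    rw [Fin.sum_univ_eq_sum_range (fun i => if i < k then f i else 0), ← Finset.sum_filter]
    congr 1
    ext i
    simp only [Finset.mem_filter, Finset.mem_range]
    omega
  have h2 : ∑ i : Fin n, (σ i * c i - s * (if (i : ℕ) < k then σ i else 0)) ≤
      ∑ i : Fin n, σ k * (c i - (if (i : ℕ) < k then s else 0)) := by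
    refine Finset.sum_le_sum fun i _ => ?_
    split_ifs with h
    · nlinarith [hσ h.le, hcs i]
    · nlinarith [hσ (not_lt.1 h), hc0 i]
  rw [Finset.sum_sub_distrib, ← Finset.mul_sum, ← Finset.mul_sum, Finset.sum_sub_distrib, h1,
    h1 fun _ => s] at h2
  simp only [Finset.sum_const, Finset.card_range, nsmul_eq_mul] at h2
  nlinarith [hσ0 k]

theorem norm_adjoint_le_singularValues_zero (A : E →ₗ[ℝ] F) (y : F) :
    ‖LinearMap.adjoint A y‖ ≤ A.singularValues 0 * ‖y‖ := by
  rcases (norm_nonneg (LinearMap.adjoint A y)).eq_or_lt with h | h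
  · rw [← h]
    exact mul_nonneg (A.singularValues_nonneg _) (norm_nonneg _)
  · have h1 : ‖LinearMap.adjoint A y‖ ^ 2 = inner ℝ y (A (LinearMap.adjoint A y)) := by
      rw [← real_inner_self_eq_norm_sq, LinearMap.adjoint_inner_left]
    have h2 := real_inner_le_norm y (A (LinearMap.adjoint A y))
    have h3 := mul_le_mul_of_nonneg_left
      (norm_map_le_singularValues_zero A (LinearMap.adjoint A y)) (norm_nonneg y)
    refine le_of_mul_le_mul_left ?_ h
    linarith

/-- A von Neumann type bound of the Frobenius inner product of two linear maps. -/
theorem abs_sum_inner_le (A B : E →ₗ[ℝ] F) {ι : Type*} [Fintype ι] (b : OrthonormalBasis ι ℝ E) :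
    |∑ i, inner ℝ (A (b i)) (B (b i))| ≤
      A.singularValues 0 * ∑ i ∈ Finset.range (finrank ℝ A.range), B.singularValues i := by
  have hbasis : ∑ i, inner ℝ (A (b i)) (B (b i)) =
      ∑ i, inner ℝ (A (rightSingularBasis B i)) (B (rightSingularBasis B i)) := by
    simp_rw [← LinearMap.adjoint_inner_right, ← LinearMap.comp_apply]
    rw [← LinearMap.trace_eq_sum_inner, ← LinearMap.trace_eq_sum_inner]
  set s := A.singularValues 0
  have hs0 : 0 ≤ s := A.singularValues_nonneg 0
  set v := rightSingularBasis B
  set u := leftSingularVector B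
  have hu : ∀ i, ‖u i‖ ≤ 1 := norm_leftSingularVector_le B
  have hle : ∀ i, |inner ℝ (A (v i)) (u i)| ≤ s := fun i => by
    refine (abs_real_inner_le_norm _ _).trans ?_
    have := norm_map_le_singularValues_zero A (v i)
    rw [v.norm_eq_one, mul_one] at this
    nlinarith [hu i, norm_nonneg (u i), norm_nonneg (A (v i))]
  -- Expand `A (v i)` in an orthonormal basis of the range of `A`. Each of its `finrank ℝ A.range`
  -- vectors contributes at most `s`, by Cauchy–Schwarz with Parseval for `v` and Bessel for `u`.
  have hsum : ∑ i, |inner ℝ (A (v i)) (u i)| ≤ (finrank ℝ A.range : ℕ) * s := by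
    set f := stdOrthonormalBasis ℝ A.range
    have h1 : ∀ i, |inner ℝ (A (v i)) (u i)| ≤
        ∑ k, |inner ℝ (v i) (LinearMap.adjoint A (f k))| * |inner ℝ (u i) (f k : F)| := fun i => by
      have h2 : A (v i) = ∑ k, inner ℝ (f k : F) (A (v i)) • (f k : F) := by
        have := congrArg Subtype.val (f.sum_repr' ⟨A (v i), LinearMap.mem_range_self A _⟩)
        rw [Submodule.coe_sum] at this
        exact this.symm
      rw [h2, sum_inner]
      refine (Finset.abs_sum_le_sum_abs _ _).trans (Finset.sum_le_sum fun k _ => ?_)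
      rw [inner_smul_left, abs_mul, LinearMap.adjoint_inner_right, real_inner_comm (A (v i)),
        real_inner_comm (u i)]
      simp
    have h3 : ∀ k, ∑ i, |inner ℝ (v i) (LinearMap.adjoint A (f k))| * |inner ℝ (u i) (f k : F)|
        ≤ s := fun k => by
      have hfk : ‖(f k : F)‖ = 1 := f.norm_eq_one k
      refine le_of_sq_le_sq ((Finset.sum_mul_sq_le_sq_mul_sq _ _ _).trans ?_) hs0
      simp only [sq_abs]
      have h4 := sum_inner_leftSingularVector_sq_le B (f k : F)
      have h5 := v.sum_sq_norm_inner_right (LinearMap.adjoint A (f k))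
      simp only [Real.norm_eq_abs, sq_abs] at h5
      have h6 := norm_adjoint_le_singularValues_zero A (f k : F)
      rw [hfk, mul_one] at h6
      rw [hfk, one_pow] at h4
      rw [h5]
      calc _ ≤ s ^ 2 * 1 := by gcongr
        _ = s ^ 2 := mul_one _
    refine (Finset.sum_le_sum fun i _ => h1 i).trans ?_
    rw [Finset.sum_comm]
    refine (Finset.sum_le_sum fun k _ => h3 k).trans ?_
    simp
  rw [hbasis]
  refine (Finset.abs_sum_le_sum_abs _ _).trans (le_trans (le_of_eq ?_)
    (sum_mul_le_mul_sum_range (LinearMap.finrank_range_le A) B.singularValues_antitone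
      B.singularValues_nonneg (fun i => abs_nonneg _) hle hsum))
  refine Finset.sum_congr rfl fun i _ => ?_
  rw [map_rightSingularBasis, inner_smul_right, abs_mul, abs_of_nonneg (B.singularValues_nonneg _)]

end Mirsky

/-! ### The null space property and first-order optimality for linear maps -/

section NullSpace

variable {E F : Type*} [NormedAddCommGroup E] [InnerProductSpace ℝ E] [FiniteDimensional ℝ E]
  [NormedAddCommGroup F] [InnerProductSpace ℝ F] [FiniteDimensional ℝ F]

/-- The linear map obtained from `T` by multiplying its `i`-th singular value by `a i`. -/
noncomputable def scaleSingularValues (T : E →ₗ[ℝ] F) : (ℕ → ℝ) →ₗ[ℝ] E →ₗ[ℝ] F :=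
  ∑ i : Fin (finrank ℝ E), (LinearMap.proj (i : ℕ) : (ℕ → ℝ) →ₗ[ℝ] ℝ).smulRight
    ((innerₛₗ ℝ (rightSingularBasis T i)).smulRight (T (rightSingularBasis T i)))

theorem scaleSingularValues_apply (T : E →ₗ[ℝ] F) (a : ℕ → ℝ) (x : E) :
    scaleSingularValues T a x = ∑ i : Fin (finrank ℝ E),
      (a i * inner ℝ (rightSingularBasis T i) x) • T (rightSingularBasis T i) := by
  simp [scaleSingularValues, LinearMap.sum_apply, smul_smul]

theorem scaleSingularValues_apply_basis (T : E →ₗ[ℝ] F) (a : ℕ → ℝ) (j : Fin (finrank ℝ E)) :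
    scaleSingularValues T a (rightSingularBasis T j) = a j • T (rightSingularBasis T j) := by
  rw [scaleSingularValues_apply, Finset.sum_eq_single j]
  · simp
  · intro i _ hij
    rw [(rightSingularBasis T).inner_eq_zero hij]
    simp
  · simp

theorem scaleSingularValues_eq_self (T : E →ₗ[ℝ] F) {a : ℕ → ℝ}
    (ha : ∀ i < finrank ℝ E, a i = 1) : scaleSingularValues T a = T := by
  refine (rightSingularBasis T).toBasis.ext fun j => ?_
  rw [OrthonormalBasis.coe_toBasis, scaleSingularValues_apply_basis, ha j j.2, one_smul]

theorem finrank_range_scaleSingularValues_le (T : E →ₗ[ℝ] F) {a : ℕ → ℝ} {s : Finset ℕ}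
    (ha : ∀ i ∉ s, a i = 0) : finrank ℝ (scaleSingularValues T a).range ≤ s.card := by
  classical
  set t : Finset (Fin (finrank ℝ E)) :=
    Finset.univ.filter fun i : Fin (finrank ℝ E) => (i : ℕ) ∈ s with ht
  have hcard : t.card ≤ s.card :=
    Finset.card_le_card_of_injOn (fun i => (i : ℕ)) (fun i hi => (Finset.mem_filter.1 hi).2)
      Fin.val_injective.injOn
  have hle : (scaleSingularValues T a).range ≤
      Submodule.span ℝ (t.image fun i => T (rightSingularBasis T i) : Finset F) := by
    rintro _ ⟨x, rfl⟩
    rw [scaleSingularValues_apply]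
    refine Submodule.sum_mem _ fun i _ => ?_
    by_cases hi : (i : ℕ) ∈ s
    · refine Submodule.smul_mem _ _ (Submodule.subset_span ?_)
      exact Finset.mem_coe.2 (Finset.mem_image_of_mem _ (by simp [ht, hi]))
    · simp [ha _ hi]
  exact (Submodule.finrank_mono hle).trans
    ((finrank_span_finset_le_card _).trans (Finset.card_image_le.trans hcard))

/-- The vectors `T vᵢ` have norm `σᵢ`. Indices of `s` beyond the dimension of `E` are harmless
because the singular values vanish there. -/
theorem sum_norm_sq_scaleSingularValues (T : E →ₗ[ℝ] F) {a : ℕ → ℝ} {s : Finset ℕ}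
    (ha : ∀ i ∉ s, a i = 0) :
    ∑ i, ‖scaleSingularValues T a (rightSingularBasis T i)‖ ^ 2 =
      ∑ i ∈ s, (a i * T.singularValues i) ^ 2 := by
  have h1 : ∀ i : Fin (finrank ℝ E), ‖scaleSingularValues T a (rightSingularBasis T i)‖ ^ 2 =
      (a i * T.singularValues i) ^ 2 := fun i => by
    rw [scaleSingularValues_apply_basis, norm_smul, norm_map_rightSingularBasis, mul_pow, mul_pow,
      Real.norm_eq_abs, sq_abs]
  simp_rw [h1]
  rw [Fin.sum_univ_eq_sum_range (fun i => (a i * T.singularValues i) ^ 2)]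
  rw [Finset.sum_subset (Finset.subset_union_left (s₂ := s)),
    Finset.sum_subset (Finset.subset_union_right (s₁ := Finset.range (finrank ℝ E)) (s₂ := s))]
  · intro i _ hi
    simp [ha i hi]
  · intro i _ hi
    rw [T.singularValues_of_finrank_le (by simpa using hi)]
    simp

/-- The null space property of linear maps with a small restricted isometry constant. -/
theorem head_le_tail_of_ker {W : Type*} [NormedAddCommGroup W] [InnerProductSpace ℝ W]
    (G : (E →ₗ[ℝ] F) →ₗ[ℝ] W) {r : ℕ} (hr : 0 < r) {δ : ℝ} (hδ : δ < 0.4404)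
    (hrip : ∀ (P : E →ₗ[ℝ] F) (b : OrthonormalBasis (Fin (finrank ℝ E)) ℝ E),
      finrank ℝ P.range ≤ 2 * r →
      (1 - δ) * ∑ i, ‖P (b i)‖ ^ 2 ≤ ‖G P‖ ^ 2 ∧ ‖G P‖ ^ 2 ≤ (1 + δ) * ∑ i, ‖P (b i)‖ ^ 2)
    {T : E →ₗ[ℝ] F} (hT : G T = 0) :
    1.1 * ∑ i ∈ Finset.range r, T.singularValues i ≤
      ∑ i ∈ Finset.Ico r (r + r * finrank ℝ E), T.singularValues i := by
  -- Taking `finrank ℝ E` blocks of length `r ≥ 1` covers all singular values, so the indicator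
  -- rescales `T` to itself.
  refine head_le_tail_of_rip (G ∘ₗ scaleSingularValues T) T.singularValues_antitone
    T.singularValues_nonneg hr (finrank ℝ E) hδ (fun s a hs ha => ?_) ?_
  · rw [← sum_norm_sq_scaleSingularValues T ha]
    exact hrip _ _ ((finrank_range_scaleSingularValues_le T ha).trans hs)
  · rw [LinearMap.comp_apply, scaleSingularValues_eq_self, hT]
    intro i hi
    rw [Set.indicator_of_mem, Pi.one_apply]
    rw [Finset.coe_range, Set.mem_Iio]
    nlinarith

theorem singularValues_sum_eq (T : E →ₗ[ℝ] F) :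
    (T.singularValues.sum fun _ s => s) = ∑ i ∈ Finset.range (finrank ℝ E), T.singularValues i :=
  Finsupp.sum_of_support_subset _ (by
    rw [T.support_singularValues]
    exact Finset.range_subset_range.2 (LinearMap.finrank_range_le T)) _ fun _ _ => rfl

theorem singularValues_sum_eq_sum_range_rank (T : E →ₗ[ℝ] F) :
    (T.singularValues.sum fun _ s => s) =
      ∑ i ∈ Finset.range (finrank ℝ T.range), T.singularValues i :=
  Finsupp.sum_of_support_subset _ T.support_singularValues.le _ fun _ _ => rfl

/-- The augmented trace norm does not decrease at first order in directions whose singular values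
have a heavy tail. -/
theorem singularValues_sum_le_of_head_le_tail {A B : E →ₗ[ℝ] F} {r L : ℕ}
    (hA : finrank ℝ A.range ≤ r) {α : ℝ} (hα : 0 < α) (hαA : 10 * A.singularValues 0 ≤ α)
    (hB : 1.1 * ∑ i ∈ Finset.range r, B.singularValues i ≤
      ∑ i ∈ Finset.Ico r L, B.singularValues i)
    {ι : Type*} [Fintype ι] (b : OrthonormalBasis ι ℝ E) :
    (A.singularValues.sum fun _ s => s) ≤ ((A + B).singularValues.sum fun _ s => s) +
      1 / α * ∑ i, inner ℝ (A (b i)) (B (b i)) := by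
  have h1 := sum_singularValues_add_ge A B
  have h2 := abs_sum_inner_le A B b
  rw [← singularValues_sum_eq_sum_range_rank A, ← singularValues_sum_eq (A + B)] at h1
  set ρ := finrank ℝ A.range
  set h := ∑ i ∈ Finset.range ρ, B.singularValues i
  set c := ∑ i, inner ℝ (A (b i)) (B (b i))
  have hh : h ≤ ∑ i ∈ Finset.range r, B.singularValues i :=
    Finset.sum_le_sum_of_subset_of_nonneg (Finset.range_subset_range.2 hA)
      fun i _ _ => B.singularValues_nonneg i
  have h0 : 0 ≤ h := Finset.sum_nonneg fun i _ => B.singularValues_nonneg i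
  have ht : ∑ i ∈ Finset.Ico r L, B.singularValues i ≤
      ∑ i ∈ Finset.Ico ρ (finrank ℝ E), B.singularValues i := by
    -- The bound `L` may exceed the dimension of `E`; only zero terms lie beyond it.
    rw [← Finset.sum_filter_ne_zero]
    refine Finset.sum_le_sum_of_subset_of_nonneg (fun i hi => ?_)
      fun i _ _ => B.singularValues_nonneg i
    rw [Finset.mem_filter, Finset.mem_Ico] at hi
    refine Finset.mem_Ico.2 ⟨hA.trans hi.1.1, ?_⟩
    by_contra! hi'
    exact hi.2 (B.singularValues_of_finrank_le hi')
  have hc : -(h / 10) ≤ 1 / α * c := by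
    have h3 : -(α * (h / 10)) ≤ c := by
      have := (abs_le.1 h2).1
      nlinarith
    calc -(h / 10) = 1 / α * -(α * (h / 10)) := by field_simp
      _ ≤ 1 / α * c := by gcongr
  linarith

end NullSpace

/-! ### Transfer between tensors and their unfoldings -/

section Unfolding

variable {N : ℕ} {I : Fin N → ℕ}

theorem insertIndex_eq (n : Fin N) (i : Fin (I n)) (j : (k : {k : Fin N // k ≠ n}) → Fin (I k)) :
    insertIndex n i j = (Equiv.piSplitAt n fun k => Fin (I k)).symm (i, j) := by
  ext k
  by_cases h : k = n
  · subst h; simp [insertIndex, Equiv.piSplitAt]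
  · simp [insertIndex, Equiv.piSplitAt, h]

/-- The mode-`n` unfolding as a linear map between Euclidean spaces. -/
noncomputable def unfoldingLin (n : Fin N) : Tensor I →ₗ[ℝ]
    EuclideanSpace ℝ ((k : {k : Fin N // k ≠ n}) → Fin (I k)) →ₗ[ℝ]
      EuclideanSpace ℝ (Fin (I n)) where
  toFun X := Matrix.toEuclideanLin (unfolding n X)
  map_add' X Y := by rw [← map_add]; rfl
  map_smul' c X := by rw [RingHom.id_apply, ← map_smul]; rfl

/-- The tensor with a given mode-`n` unfolding. -/
def foldMatrix (n : Fin N) :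
    Matrix (Fin (I n)) ((k : {k : Fin N // k ≠ n}) → Fin (I k)) ℝ →ₗ[ℝ] Tensor I where
  toFun M := WithLp.toLp 2 fun x => M (x n) fun k => x k
  map_add' _ _ := rfl
  map_smul' _ _ := rfl

theorem unfolding_foldMatrix (n : Fin N)
    (M : Matrix (Fin (I n)) ((k : {k : Fin N // k ≠ n}) → Fin (I k)) ℝ) :
    unfolding n (foldMatrix n M) = M := by
  ext i j
  have h := (Equiv.piSplitAt n fun k => Fin (I k)).apply_symm_apply (i, j)
  rw [← insertIndex_eq] at h
  change M (Equiv.piSplitAt n (fun k => Fin (I k)) (insertIndex n i j)).1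
    (Equiv.piSplitAt n (fun k => Fin (I k)) (insertIndex n i j)).2 = M i j
  rw [h]

theorem foldMatrix_unfolding (n : Fin N) (X : Tensor I) : foldMatrix n (unfolding n X) = X := by
  ext x
  have h := (Equiv.piSplitAt n fun k => Fin (I k)).symm_apply_apply x
  change X (insertIndex n (x n) fun k => x k) = X x
  rw [insertIndex_eq]
  exact congrArg X h

/-- The tensor whose mode-`n` unfolding represents a given linear map. -/
noncomputable def fold (n : Fin N) :
    (EuclideanSpace ℝ ((k : {k : Fin N // k ≠ n}) → Fin (I k)) →ₗ[ℝ]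
      EuclideanSpace ℝ (Fin (I n))) →ₗ[ℝ] Tensor I :=
  foldMatrix n ∘ₗ (Matrix.toEuclideanLin (𝕜 := ℝ)).symm.toLinearMap

theorem unfoldingLin_fold (n : Fin N)
    (P : EuclideanSpace ℝ ((k : {k : Fin N // k ≠ n}) → Fin (I k))
      →ₗ[ℝ] EuclideanSpace ℝ (Fin (I n))) :
    unfoldingLin n (fold n P) = P := by
  change Matrix.toEuclideanLin (unfolding n (fold n P)) = P
  rw [fold, LinearMap.comp_apply, unfolding_foldMatrix]
  exact LinearEquiv.apply_symm_apply _ _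

theorem fold_unfoldingLin (n : Fin N) (X : Tensor I) : fold n (unfoldingLin n X) = X := by
  refine Eq.trans ?_ (foldMatrix_unfolding n X)
  exact congrArg (foldMatrix n) (LinearEquiv.symm_apply_apply _ _)

theorem rank_unfolding (n : Fin N) (X : Tensor I) :
    (unfolding n X).rank = finrank ℝ (unfoldingLin n X).range := by
  rw [Matrix.rank_eq_finrank_range_toLin _ (PiLp.basisFun 2 ℝ _) (PiLp.basisFun 2 ℝ _),
    ← Matrix.toLpLin_eq_toLin]
  rfl

theorem traceNorm_unfolding (n : Fin N) (X : Tensor I) :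
    traceNorm (unfolding n X) = (unfoldingLin n X).singularValues.sum fun _ s => s := rfl

theorem sum_inner_unfoldingLin_basisFun (n : Fin N) (X Y : Tensor I) :
    ∑ j, inner ℝ (unfoldingLin n X (EuclideanSpace.basisFun _ ℝ j))
      (unfoldingLin n Y (EuclideanSpace.basisFun _ ℝ j)) = inner ℝ X Y := by
  have h : ∀ (X : Tensor I) i j, unfoldingLin n X (EuclideanSpace.basisFun _ ℝ j) i =
      X (insertIndex n i j) := fun X i j => by
    simp [unfoldingLin, unfolding, Matrix.toLpLin_apply]
  simp_rw [PiLp.inner_apply, h]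
  rw [← (Equiv.piSplitAt n fun k => Fin (I k)).symm.sum_comp, Fintype.sum_prod_type,
    Finset.sum_comm]
  simp_rw [insertIndex_eq]

/-- The left side is a trace, hence independent of the basis; singular bases may thus replace the
coordinate one. -/
theorem sum_inner_unfoldingLin (n : Fin N) (X Y : Tensor I) {ι : Type*} [Fintype ι]
    (b : OrthonormalBasis ι ℝ (EuclideanSpace ℝ ((k : {k : Fin N // k ≠ n}) → Fin (I k)))) :
    ∑ j, inner ℝ (unfoldingLin n X (b j)) (unfoldingLin n Y (b j)) = inner ℝ X Y := by
  rw [← sum_inner_unfoldingLin_basisFun n]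
  simp_rw [← LinearMap.adjoint_inner_right, ← LinearMap.comp_apply]
  rw [← LinearMap.trace_eq_sum_inner, ← LinearMap.trace_eq_sum_inner]

/-- If only the zero tensor has low rank, every real number is admissible and the infimum `0` is a
default value, not a minimum; `0` still serves as a witness because `ε > 0`. -/
theorem exists_mem_ripBounds_of_ripConstant_lt {p : ℕ}
    {F : Tensor I →ₗ[ℝ] EuclideanSpace ℝ (Fin p)} {r : Fin N → ℕ} {ε : ℝ} (hε : 0 < ε)
    (h : ripConstant F r < ε) : ∃ δ ∈ ripBounds F r, δ < ε := by
  by_cases hne : ∃ X ∈ lowRank (I := I) r, X ≠ 0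
  · exact ⟨_, (isLeast_ripConstant F r hne).1, h⟩
  · push Not at hne
    exact ⟨0, fun X hX => by simp [hne X hX], hε⟩

theorem head_le_tail_of_mem_ripBounds {p : ℕ} {F : Tensor I →ₗ[ℝ] EuclideanSpace ℝ (Fin p)}
    {n : Fin N} {r : ℕ} (hr : 0 < r) {δ : ℝ} (hδ : δ < 0.4404)
    (hF : δ ∈ ripBounds F (Function.update I n (2 * r))) {H : Tensor I} (hH : F H = 0) :
    1.1 * ∑ i ∈ Finset.range r, (unfoldingLin n H).singularValues i ≤
      ∑ i ∈ Finset.Ico r (r + r * finrank ℝ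
        (EuclideanSpace ℝ ((k : {k : Fin N // k ≠ n}) → Fin (I k)))),
        (unfoldingLin n H).singularValues i := by
  refine head_le_tail_of_ker (F ∘ₗ fold n) hr hδ (fun P b hP => ?_)
    (by rw [LinearMap.comp_apply, fold_unfoldingLin, hH])
  have hnorm : ∑ i, ‖P (b i)‖ ^ 2 = ‖fold n P‖ ^ 2 := by
    rw [← real_inner_self_eq_norm_sq, ← sum_inner_unfoldingLin n _ _ b, unfoldingLin_fold]
    simp
  rw [hnorm]
  -- Only mode `n` carries a real rank constraint; in the other modes the bound `I k` is the number
  -- of rows.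
  refine hF (fold n P) fun k => ?_
  rcases eq_or_ne k n with rfl | hk
  · rwa [rank_unfolding, unfoldingLin_fold, Function.update_self]
  · rw [Function.update_of_ne hk]
    exact (Matrix.rank_le_card_height _).trans_eq (Fintype.card_fin _)

theorem traceNorm_unfolding_le {p : ℕ} {F : Tensor I →ₗ[ℝ] EuclideanSpace ℝ (Fin p)}
    {n : Fin N} {r : ℕ} (hF : ripConstant F (Function.update I n (2 * r)) < 0.4404)
    {X : Tensor I} (hX : (unfolding n X).rank ≤ r) {α : ℝ} (hα : 0 < α)
    (hαX : 10 * matrixSpectralNorm (unfolding n X) ≤ α) {H : Tensor I} (hH : F H = 0) :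
    traceNorm (unfolding n X) ≤ traceNorm (unfolding n (X + H)) + 1 / α * inner ℝ X H := by
  rw [rank_unfolding] at hX
  rw [traceNorm_unfolding, traceNorm_unfolding, map_add,
    ← sum_inner_unfoldingLin n X H (EuclideanSpace.basisFun _ ℝ)]
  -- Blocks of length `r` require `r > 0`; for `r = 0` the unfolding of `X` vanishes and
  -- nonnegativity of the trace norm suffices.
  rcases Nat.eq_zero_or_pos r with rfl | hr
  · have h0 : unfoldingLin n X = 0 := by
      rw [← LinearMap.range_eq_bot, ← Submodule.finrank_eq_zero (R := ℝ)]
      omega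
    rw [h0]
    simp only [LinearMap.singularValues_zero, Finsupp.sum_zero_index, zero_add,
      LinearMap.zero_apply, inner_zero_left, Finset.sum_const_zero, mul_zero, add_zero]
    exact Finset.sum_nonneg fun i _ => LinearMap.singularValues_nonneg _ i
  · obtain ⟨δ, hδ, hlt⟩ := exists_mem_ripBounds_of_ripConstant_lt (by norm_num) hF
    exact singularValues_sum_le_of_head_le_tail hX hα hαX
      (head_le_tail_of_mem_ripBounds hr hlt hδ hH) _

end Unfolding

end TensorRecovery

/-! ### Exact recovery -/

theorem theorem9 {N : ℕ} [NeZero N] (I : Fin N → ℕ) {p : ℕ}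
    (F : Tensor I →ₗ[ℝ] EuclideanSpace ℝ (Fin p)) (r : Fin N → ℕ)
    (X₀ : Tensor I) (hX₀ : X₀ ∈ lowRank r)
    (hRIP : ∀ n : Fin N, ripConstant F (Function.update I n (2 * r n)) < 0.4404)
    (α : ℝ) (hα : 0 < α)
    (hαX₀ : 10 * Finset.univ.sup' Finset.univ_nonempty
      (fun n : Fin N => matrixSpectralNorm (unfolding n X₀)) ≤ α)
    (b : EuclideanSpace ℝ (Fin p)) (hb : b = F X₀) :
    augmentedSolutions α F b = {X₀} := by
  have hN : (0 : ℝ) < N := by exact_mod_cast Nat.pos_of_neZero N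
  -- The quadratic surplus is what makes the minimizer unique.
  have key : ∀ Y, F Y = b →
      augmentedObjective α X₀ + 1 / (2 * α) * ‖Y - X₀‖ ^ 2 ≤ augmentedObjective α Y := by
    intro Y hY
    obtain ⟨H, rfl⟩ : ∃ H, Y = X₀ + H := ⟨Y - X₀, by abel⟩
    have hH : F H = 0 := by
      rw [map_add, hb] at hY
      simpa using hY
    have hmode : ∀ n, traceNorm (unfolding n X₀) ≤
        traceNorm (unfolding n (X₀ + H)) + 1 / α * inner ℝ X₀ H := fun n =>
      traceNorm_unfolding_le (hRIP n) (hX₀ n) hα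
        ((mul_le_mul_of_nonneg_left (Finset.le_sup'
          (fun n : Fin N => matrixSpectralNorm (unfolding n X₀)) (Finset.mem_univ n))
          (by norm_num)).trans hαX₀) hH
    have hsum : tensorTraceNorm X₀ ≤ tensorTraceNorm (X₀ + H) + 1 / α * inner ℝ X₀ H := by
      have h1 := mul_le_mul_of_nonneg_left (Finset.sum_le_sum fun n (_ : n ∈ Finset.univ) =>
        hmode n) (one_div_nonneg.2 hN.le)
      rw [Finset.sum_add_distrib, mul_add, Finset.sum_const, Finset.card_univ, Fintype.card_fin,
        nsmul_eq_mul, ← mul_assoc (1 / (N : ℝ)) (N : ℝ), one_div_mul_cancel hN.ne', one_mul] at h1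
      exact h1
    have hsq : 1 / (2 * α) * ‖X₀ + H‖ ^ 2 = 1 / (2 * α) * ‖X₀‖ ^ 2 + 1 / α * inner ℝ X₀ H +
        1 / (2 * α) * ‖H‖ ^ 2 := by
      rw [norm_add_sq_real]
      field_simp
    rw [augmentedObjective, augmentedObjective, hsq, add_sub_cancel_left]
    linarith
  have hα2 : 0 < 1 / (2 * α) := by positivity
  ext X
  rw [Set.mem_singleton_iff]
  constructor
  · rintro ⟨hXb, hX⟩
    have h1 := key X hXb
    have h2 := hX X₀ hb.symm
    have h3 : ‖X - X₀‖ ^ 2 ≤ 0 := by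
      by_contra! h
      nlinarith [mul_pos hα2 h]
    exact sub_eq_zero.1 (norm_eq_zero.1 (pow_eq_zero_iff two_ne_zero |>.1
      (le_antisymm h3 (sq_nonneg _))))
  · rintro rfl
    exact ⟨hb.symm, fun Y hY => by nlinarith [key Y hY, mul_nonneg hα2.le (sq_nonneg ‖Y - X‖)]⟩
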